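/- Let $M$ be a finite monoid that is (von Neumann) regular (for every $m\in M$ there is $a\in M$ with $mam=m$) and left duo ($mM\subseteq Mm$ for every $m\in M$). For $m\in M$, let $m^\omega$ be the unique idempotent positive power of $m$. Let $B$ be the set of idempotents of $M$, which is a submonoid, partially ordered by $e\le f$ if and only if $fe=e$. Let $\Lambda(B)=\{Be\mid e\in B\}$, ordered by inclusion, and let $\sigma\colon M\to\Lambda(B)$ be the map $\sigma(m)=Bm^\omega$. For $e\in B$, let $G_e$ be the maximal subgroup of $M$ at $e$, that is, the group of units of the monoid $eMe$. Each $m\in M$ lies in $G_{m^\omega}$; let $m^\dagger$ be its inverse in this group. For $X\in\Lambda(B)$, let $M_{\ge X}=\{m\in M\mid \sigma(m)\ge X\}$, which is a submonoid, and $B_{\ge X}=B\cap M_{\ge X}$. Then $M_{\ge X}$ acts on the poset $B_{\ge X}$ by the order preserving maps $e\mapsto mem^\dagger$, and hence by simplicial maps on the order complex $\Delta(B_{\ge X})$, whose simplices are the nonempty finite chains of $B_{\ge X}$. Let $K$ be a field whose characteristic does not divide the order of any maximal subgroup of $M$. Let $X\in\Lambda(B)$, let $e\in B$ with $\sigma(e)=X$,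 put $G_X=G_e$, and let $V$ be a simple $KG_X$-module. View $V$ as a $KM_{\ge X}$-module via the homomorphism $M_{\ge X}\to G_X$, $m\mapsto em$, and view the tensor products over $K$ of the simplicial chain modules $C_q(\Delta(B_{\ge X}),K)$ with $V$ as $KM_{\ge X}$-modules by the diagonal action of $M_{\ge X}$. Inflate all these modules to $KM$-modules along the algebra homomorphism $\rho_X\colon KM\to KM_{\ge X}$ with $\rho_X(m)=m$ for $m\in M_{\ge X}$ and $\rho_X(m)=0$ for $m\in M\setminus M_{\ge X}$. Then the augmented complex $$\cdots\to C_1(\Delta(B_{\ge X}),K)\otimes_K V\to C_0(\Delta(B_{\ge X}),K)\otimes_K V\to V\to 0,$$ with differentials $\partial\otimes\mathrm{id}_V$ and augmentation $[p]\otimes v\mapsto v$ for vertices $p$, is a projective resolution of $V$ over $KM$: it is exact, and each $C_q(\Delta(B_{\ge X}),K)\otimes_K V$ with $q\ge 0$ is a projective $KM$-module. -/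

import Mathlib

open scoped MonoidAlgebra TensorProduct

namespace LeftDuo

/-! ### Finite regular left duo monoids and their idempotents -/

/-- A monoid is (von Neumann) regular if each `m` can be written as `m * a * m`. -/
class IsRegularMonoid (M : Type*) [Monoid M] : Prop where
  exists_mul_mul_eq : ∀ m : M, ∃ a : M, m * a * m = m

/-- A monoid is left duo if `mM ⊆ Mm` for all `m`. -/
class IsLeftDuo (M : Type*) [Monoid M] : Prop where
  exists_mul_eq_mul : ∀ m x : M, ∃ y : M, m * x = y * m

/-- The set `E(M)` of idempotents; for a left duo monoid this is the left regular band `B`. -/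
@[ext] structure Idem (M : Type*) [Monoid M] where
  /-- The underlying element of `M`. -/
  val : M
  isIdem : IsIdempotentElem val

section Band

variable {M : Type*} [Monoid M]

instance : CoeOut (Idem M) M := ⟨Idem.val⟩

theorem Idem.mul_self (e : Idem M) : (e : M) * e = e := e.isIdem

/-- Idempotents are right semicentral: `e m e = e m`. -/
theorem idem_mul_mul [IsLeftDuo M] (e : Idem M) (m : M) : (e : M) * m * e = e * m := by
  obtain ⟨y, hy⟩ := IsLeftDuo.exists_mul_eq_mul (e : M) m
  rw [hy, mul_assoc, e.mul_self]

/-- The left regular band structure on `B = E(M)`. -/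
instance [IsLeftDuo M] : Monoid (Idem M) where
  mul e f := ⟨(e : M) * f, by
    change (e : M) * f * (e * f) = e * f
    rw [← mul_assoc, idem_mul_mul, mul_assoc, f.mul_self]⟩
  one := ⟨1, IsIdempotentElem.one⟩
  mul_assoc _ _ _ := Idem.ext (mul_assoc _ _ _)
  one_mul _ := Idem.ext (one_mul _)
  mul_one _ := Idem.ext (mul_one _)

theorem Idem.coe_mul [IsLeftDuo M] (e f : Idem M) : ((e * f : Idem M) : M) = (e : M) * f := rfl

/-- The partial order on `B`: `e ≤ f` iff `f e = e`. -/
instance [IsLeftDuo M] : PartialOrder (Idem M) where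
  le e f := f * e = e
  le_refl e := Idem.ext e.mul_self
  le_trans e f g hef hfg := by
    rw [← hef, ← mul_assoc, hfg]
  le_antisymm e f hef hfe := by
    apply Idem.ext
    have h1 : (f : M) * e = e := congrArg Idem.val hef
    have h2 : (e : M) * f = f := congrArg Idem.val hfe
    calc (e : M) = e * (f * e) := by rw [h1, e.mul_self]
      _ = e * f * e := (mul_assoc _ _ _).symm
      _ = e * f := idem_mul_mul e f
      _ = f := h2

theorem Idem.le_iff [IsLeftDuo M] {e f : Idem M} : e ≤ f ↔ (f : M) * e = e :=
  ⟨fun h => congrArg Idem.val h, fun h => Idem.ext h⟩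

end Band

/-! ### Idempotent powers and the group inverse `m†` -/

section Omega

variable {M : Type*} [Monoid M] [Finite M]

theorem exists_idempotent_pow (m : M) : ∃ n : ℕ, 0 < n ∧ IsIdempotentElem (m ^ n) := by
  obtain ⟨i, j, hij, h⟩ := Finite.exists_ne_map_eq_of_infinite (fun n : ℕ => m ^ n)
  wlog hlt : i < j generalizing i j
  · exact this j i hij.symm h.symm (by omega)
  obtain ⟨p, rfl⟩ : ∃ p, j = i + p := ⟨j - i, by omega⟩
  have hp : 0 < p := by omega
  have key : ∀ k r : ℕ, m ^ (i + r + k * p) = m ^ (i + r) := by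
    intro k r
    induction k with
    | zero => simp
    | succ k ih =>
      have h' : m ^ (i + p) = m ^ i := h.symm
      calc m ^ (i + r + (k + 1) * p) = m ^ (i + p) * m ^ (r + k * p) := by
            rw [← pow_add]; congr 1; ring
        _ = m ^ (i + r + k * p) := by rw [h', ← pow_add]; congr 1; ring
        _ = m ^ (i + r) := ih
  refine ⟨(i + 1) * p, by positivity, ?_⟩
  obtain ⟨r, hr⟩ : ∃ r, (i + 1) * p = i + r :=
    ⟨(i + 1) * p - i, by have : i + 1 ≤ (i + 1) * p := Nat.le_mul_of_pos_right _ hp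
                         omega⟩
  have := key (i + 1) r
  rw [← hr] at this
  change m ^ _ * m ^ _ = _
  rw [← pow_add, this]

open Classical in
/-- The least positive exponent `n` such that `m ^ n` is idempotent. -/
noncomputable def omegaExp (m : M) : ℕ := Nat.find (exists_idempotent_pow m)

theorem omegaExp_pos (m : M) : 0 < omegaExp m := by
  classical
  exact (Nat.find_spec (exists_idempotent_pow m)).1

/-- The unique idempotent positive power `m^ω` of `m`. -/
noncomputable def omega (m : M) : Idem M :=
  ⟨m ^ omegaExp m, by
    classical
    exact (Nat.find_spec (exists_idempotent_pow m)).2⟩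

theorem omega_eq (m : M) : (omega m : M) = m ^ omegaExp m := rfl

/-- The element `m† = m^(2n-1)`, where `m ^ n = m^ω`. In a regular left duo monoid it is the inverse
of `m` in the maximal subgroup with identity `m^ω`; see `omega_mul_self`, `mul_dagger` and the
lemmas next to them. -/
noncomputable def dagger (m : M) : M := m ^ (2 * omegaExp m - 1)

theorem mul_dagger (m : M) : m * dagger m = omega m := by
  have h := omegaExp_pos m
  have h2 : (omega m : M) * omega m = omega m := (omega m).mul_self
  rw [dagger, ← pow_succ', show 2 * omegaExp m - 1 + 1 = omegaExp m + omegaExp m by omega, pow_add]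
  exact h2

theorem dagger_mul (m : M) : dagger m * m = omega m := by
  rw [← mul_dagger, dagger, ← pow_succ, ← pow_succ']

theorem omega_mul_dagger (m : M) : (omega m : M) * dagger m = dagger m := by
  have h := omegaExp_pos m
  have h2 : (omega m : M) * omega m = omega m := (omega m).mul_self
  have h3 : dagger m = (omega m : M) * m ^ (omegaExp m - 1) := by
    rw [dagger, omega_eq, ← pow_add]; congr 1; omega
  rw [h3, ← mul_assoc, h2]

theorem dagger_mul_omega (m : M) : dagger m * omega m = dagger m := by
  conv_rhs => rw [← omega_mul_dagger]
  rw [dagger, omega_eq, ← pow_add, ← pow_add, add_comm]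

variable [IsRegularMonoid M] [IsLeftDuo M]

theorem mul_omega_self (m : M) : m * omega m = m := by
  obtain ⟨a, ha⟩ := IsRegularMonoid.exists_mul_mul_eq m
  have hk : ∀ k : ℕ, ∃ x, a * m = x * m ^ (k + 1) := by
    intro k
    induction k with
    | zero => exact ⟨a, by simp⟩
    | succ k ih =>
      obtain ⟨x, hx⟩ := ih
      obtain ⟨y, hy⟩ := IsLeftDuo.exists_mul_eq_mul (m ^ (k + 1)) a
      refine ⟨x * y, ?_⟩
      calc a * m = a * m * (a * m) := by rw [mul_assoc, ← mul_assoc m, ha]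
        _ = x * (m ^ (k + 1) * a) * m := by rw [hx]; simp only [mul_assoc]; rw [← hx]
        _ = x * y * m ^ (k + 1 + 1) := by rw [hy, pow_succ m (k + 1)]; simp only [mul_assoc]
  obtain ⟨x, hx⟩ := hk (omegaExp m - 1)
  rw [Nat.sub_add_cancel (omegaExp_pos m), ← omega_eq] at hx
  calc m * omega m = m * (a * m) * omega m := by rw [← mul_assoc, ha]
    _ = m * (x * (omega m * omega m)) := by rw [hx]; simp only [mul_assoc]
    _ = m * a * m := by rw [(omega m).mul_self, ← hx, mul_assoc]
    _ = m := ha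

theorem omega_mul_self (m : M) : (omega m : M) * m = m := by
  conv_rhs => rw [← mul_omega_self m]
  rw [omega_eq, ← pow_succ, ← pow_succ']

theorem mul_mul_omega (m x : M) : m * x * omega m = m * x := by
  obtain ⟨y, hy⟩ := IsLeftDuo.exists_mul_eq_mul m x
  rw [hy, mul_assoc, mul_omega_self]

/-- The element `m e m†` of `B`, for `m ∈ M` and `e ∈ B`. -/
noncomputable def act (m : M) (e : Idem M) : Idem M :=
  ⟨m * e * dagger m, by
    change m * e * dagger m * (m * e * dagger m) = m * e * dagger m
    calc m * e * dagger m * (m * e * dagger m)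
        = m * (e : M) * (dagger m * m) * (e * dagger m) := by simp only [mul_assoc]
      _ = m * (e * e) * dagger m := by rw [dagger_mul, mul_mul_omega]; simp only [mul_assoc]
      _ = m * e * dagger m := by rw [e.mul_self]⟩

theorem act_coe (m : M) (e : Idem M) : (act m e : M) = m * e * dagger m := rfl

theorem act_mul_self (m : M) (e : Idem M) : (act m e : M) * m = m * e := by
  rw [act_coe, mul_assoc, dagger_mul, mul_mul_omega]

theorem act_one (e : Idem M) : act 1 e = e := by
  apply Idem.ext
  simp [act_coe, dagger]

theorem act_mul (m n : M) (e : Idem M) : act (m * n) e = act m (act n e) := by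
  have h1 : (act (m * n) e : M) * (m * n) = m * n * e := act_mul_self _ _
  have h2 : (act m (act n e) : M) * (m * n) = m * n * e := by
    rw [← mul_assoc, act_mul_self, mul_assoc, act_mul_self, mul_assoc]
  have e1 : (act (m * n) e : M) = m * n * e * dagger (m * n) := rfl
  have e2 : (act m (act n e) : M) = m * n * e * (dagger n * dagger m) := by
    rw [act_coe, act_coe]; simp only [mul_assoc]
  apply le_antisymm
  · rw [Idem.le_iff]
    calc (act m (act n e) : M) * act (m * n) e
        = act m (act n e) * (act m (act n e) * (m * n)) * dagger (m * n) := by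
          rw [h2, mul_assoc, ← e1]
      _ = act m (act n e) * (m * n) * dagger (m * n) := by
          rw [← mul_assoc _ _ (m * n), Idem.mul_self]
      _ = act (m * n) e := by rw [h2, ← e1]
  · rw [Idem.le_iff]
    calc (act (m * n) e : M) * act m (act n e)
        = act (m * n) e * (act (m * n) e * (m * n)) * (dagger n * dagger m) := by
          rw [h1, mul_assoc, ← e2]
      _ = act (m * n) e * (m * n) * (dagger n * dagger m) := by
          rw [← mul_assoc _ _ (m * n), Idem.mul_self]
      _ = act m (act n e) := by rw [h1, ← e2]

theorem act_mono (m : M) : Monotone (act m) := by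
  intro e f h
  rw [Idem.le_iff] at h ⊢
  calc (act m f : M) * act m e = (act m f * m) * e * dagger m := by
        rw [act_coe m e]; simp only [mul_assoc]
    _ = m * (f * e) * dagger m := by rw [act_mul_self]; simp only [mul_assoc]
    _ = act m e := by rw [h, act_coe]

end Omega

/-! ### The lattice `Λ(B)`, the map `σ` and contractions -/

section Contraction

variable {M : Type*} [Monoid M] [IsLeftDuo M]

/-- The principal left ideal `Be` of `B`. -/
def leftIdeal (e : Idem M) : Set (Idem M) := {b | ∃ c : Idem M, b = c * e}

variable (M) in
/-- The poset `Λ(B)` of principal left ideals of `B`, ordered by inclusion. -/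
abbrev Lam : Type _ := Set.range (leftIdeal : Idem M → Set (Idem M))

theorem leftIdeal_subset_iff {e f : Idem M} : leftIdeal e ⊆ leftIdeal f ↔ (e : M) * f = e := by
  constructor
  · intro h
    obtain ⟨c, hc⟩ := h (show e ∈ leftIdeal e from ⟨1, (one_mul e).symm⟩)
    rw [hc, Idem.coe_mul, mul_assoc, f.mul_self]
  · rintro h b ⟨c, rfl⟩
    refine ⟨c * e, ?_⟩
    rw [mul_assoc]
    congr 1
    exact Idem.ext h.symm

variable [Finite M]

/-- The map `σ : M → Λ(B)`, `σ(m) = B m^ω`. -/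
noncomputable def sigma (m : M) : Lam M := ⟨leftIdeal (omega m), omega m, rfl⟩

variable [IsRegularMonoid M]

theorem le_sigma_iff (e : Idem M) (m : M) :
    leftIdeal e ⊆ (sigma m).1 ↔ ∃ x : M, (e : M) = x * m := by
  rw [sigma, leftIdeal_subset_iff]
  constructor
  · intro h
    refine ⟨e * dagger m, ?_⟩
    rw [mul_assoc, dagger_mul, h]
  · rintro ⟨x, hx⟩
    rw [hx, mul_assoc, mul_omega_self]

theorem le_sigma_mul (X : Lam M) (m n : M) : X ≤ sigma (m * n) ↔ X ≤ sigma m ∧ X ≤ sigma n := by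
  obtain ⟨_, e, rfl⟩ := X
  change leftIdeal e ⊆ (sigma _).1 ↔
    leftIdeal e ⊆ (sigma m).1 ∧ leftIdeal e ⊆ (sigma n).1
  simp only [le_sigma_iff]
  constructor
  · rintro ⟨x, hx⟩
    obtain ⟨y, hy⟩ := IsLeftDuo.exists_mul_eq_mul m n
    exact ⟨⟨x * y, by rw [hx, hy, mul_assoc]⟩, ⟨x * m, by rw [hx, mul_assoc]⟩⟩
  · rintro ⟨⟨x, hx⟩, ⟨y, hy⟩⟩
    obtain ⟨z, hz⟩ := IsLeftDuo.exists_mul_eq_mul m y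
    refine ⟨x * z, ?_⟩
    calc (e : M) = e * e := e.mul_self.symm
      _ = x * m * (y * n) := by rw [← hx, ← hy]
      _ = x * (m * y) * n := by simp only [mul_assoc]
      _ = x * z * (m * n) := by rw [hz]; simp only [mul_assoc]

/-- The contraction `M_{≥X} = {m | σ(m) ≥ X}`, a submonoid of `M`. -/
noncomputable def contraction (X : Lam M) : Submonoid M where
  carrier := {m | X ≤ sigma m}
  mul_mem' {m n} hm hn := (le_sigma_mul X m n).2 ⟨hm, hn⟩
  one_mem' := by
    obtain ⟨_, e, rfl⟩ := X
    exact (le_sigma_iff e 1).2 ⟨e, (mul_one _).symm⟩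

theorem mem_contraction {X : Lam M} {m : M} : m ∈ contraction X ↔ X ≤ sigma m := Iff.rfl

theorem mul_mem_contraction {X : Lam M} {m n : M} :
    m * n ∈ contraction X ↔ m ∈ contraction X ∧ n ∈ contraction X := le_sigma_mul X m n

/-- The band `B_{≥X}` of idempotents of `M_{≥X}`, with the order of `B`. -/
abbrev IdemGE (X : Lam M) : Type _ := {f : Idem M // (f : M) ∈ contraction X}

/-- The action of `M_{≥X}` on the poset `B_{≥X}` by order preserving maps, `(m, e) ↦ m e m†`. -/
noncomputable def actHom (X : Lam M) : contraction X →* (IdemGE X →o IdemGE X) where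
  toFun m :=
    { toFun := fun f => ⟨act (m : M) f.1,
        (contraction X).mul_mem ((contraction X).mul_mem m.2 f.2) ((contraction X).pow_mem m.2 _)⟩
      monotone' := fun _ _ h => act_mono (m : M) h }
  map_one' := by
    ext f : 3
    exact act_one f.1
  map_mul' m n := by
    ext f : 3
    exact act_mul (m : M) n f.1

end Contraction

/-! ### Maximal subgroups -/

section MaximalSubgroup

variable {M : Type*} [Monoid M]

/-- The local monoid `eMe`, with identity `e`. -/
@[ext] structure LocalMonoid (e : Idem M) where
  /-- The underlying element of `M`. -/
  val : M
  left_mul : (e : M) * val = val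
  mul_right : val * e = val

instance (e : Idem M) : Monoid (LocalMonoid e) where
  mul a b := ⟨a.val * b.val, by rw [← mul_assoc, a.left_mul], by rw [mul_assoc, b.mul_right]⟩
  one := ⟨e, e.mul_self, e.mul_self⟩
  mul_assoc _ _ _ := LocalMonoid.ext (mul_assoc _ _ _)
  one_mul a := LocalMonoid.ext a.left_mul
  mul_one a := LocalMonoid.ext a.mul_right

instance [Finite M] (e : Idem M) : Finite (LocalMonoid e) :=
  Finite.of_injective LocalMonoid.val fun _ _ => LocalMonoid.ext

/-- The maximal subgroup `G_e` of `M` at the idempotent `e`: the group of units of `eMe`. -/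
abbrev MaxSubgroup (e : Idem M) : Type _ := (LocalMonoid e)ˣ

variable [IsLeftDuo M] [Finite M] [IsRegularMonoid M]

/-- If `X = σ(e)`, the homomorphism `M_{≥X} → G_e`, `m ↦ em`. (It is the group completion
of `M_{≥X}`.) -/
noncomputable def toMaxSubgroup {X : Lam M} (e : Idem M) (he : sigma (e : M) = X) :
    contraction X →* MaxSubgroup e :=
  let f : contraction X →* LocalMonoid e :=
    { toFun := fun m => ⟨(e : M) * m, by rw [← mul_assoc, e.mul_self], idem_mul_mul e m⟩
      map_one' := LocalMonoid.ext (mul_one _)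
      map_mul' := fun m n => LocalMonoid.ext (by
        change (e : M) * (m * n) = e * m * (e * n)
        rw [← mul_assoc, ← mul_assoc, idem_mul_mul]) }
  IsUnit.liftRight f (by
    intro m
    have h0 : leftIdeal e ⊆ (sigma (e : M)).1 :=
      (le_sigma_iff e e).2 ⟨1, (one_mul _).symm⟩
    have h1 : leftIdeal e ⊆ (sigma (m : M)).1 := by
      refine h0.trans ?_
      rw [he]
      exact m.2
    obtain ⟨x, hx⟩ := (le_sigma_iff e m).1 h1
    refine IsUnit.of_mul_eq_one_right
      (⟨(e : M) * x, by rw [← mul_assoc, e.mul_self], idem_mul_mul e x⟩ : LocalMonoid e) ?_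
    apply LocalMonoid.ext
    change (e : M) * x * (e * m) = e
    rw [← mul_assoc, idem_mul_mul, mul_assoc, ← hx, e.mul_self])

theorem coe_toMaxSubgroup {X : Lam M} (e : Idem M) (he : sigma (e : M) = X) (m : contraction X) :
    ((toMaxSubgroup e he m : LocalMonoid e).val : M) = e * m := rfl

end MaximalSubgroup

/-! ### The simplicial chain complex of an order complex -/

section Chains

variable {P : Type*} [PartialOrder P]

/-- The `q`-simplices of the order complex `Δ(P)`: chains `p_0 < ⋯ < p_q`, i.e. `(q+1)`-element
chains of `P`, oriented by the order of `P`. -/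
abbrev Simplex (P : Type*) [PartialOrder P] (q : ℕ) : Type _ :=
  {c : Fin (q + 1) → P // StrictMono c}

/-- The group `C_q(Δ(P), K)` of simplicial `q`-chains. -/
abbrev Chains (K P : Type*) [Field K] [PartialOrder P] (q : ℕ) : Type _ := Simplex P q →₀ K

variable (K : Type*) [Field K]

open Classical in
/-- The `q`-chain `[p_0, …, p_q]`, which is zero unless `p_0 < ⋯ < p_q`. (Used for weakly
increasing sequences, so that it vanishes exactly when some vertex is repeated.) -/
noncomputable def simplexChain {q : ℕ} (c : Fin (q + 1) → P) : Chains K P q :=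
  if h : StrictMono c then Finsupp.single ⟨c, h⟩ 1 else 0

/-- The simplicial boundary `[p_0, …, p_{q+1}] ↦ ∑ i, (-1)^i [p_0, …, p̂_i, …, p_{q+1}]`. -/
noncomputable def boundary (P : Type*) [PartialOrder P] (q : ℕ) :
    Chains K P (q + 1) →ₗ[K] Chains K P q :=
  Finsupp.linearCombination K fun c =>
    ∑ i : Fin (q + 2), (-1 : K) ^ (i : ℕ) • simplexChain K (c.1 ∘ i.succAbove)

/-- The augmentation `C_0(Δ(P), K) → K`, `[p] ↦ 1`. -/
noncomputable def augmentation (P : Type*) [PartialOrder P] : Chains K P 0 →ₗ[K] K :=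
  Finsupp.linearCombination K fun _ => (1 : K)

/-- The map on simplicial chains induced by an order preserving map `f`:
`[p_0, …, p_q] ↦ [f p_0, …, f p_q]`, which is zero if some vertex is repeated. -/
noncomputable def chainMap (q : ℕ) (f : P →o P) : Chains K P q →ₗ[K] Chains K P q :=
  Finsupp.linearCombination K fun c => simplexChain K (f ∘ c.1)

theorem simplexChain_of_strictMono {q : ℕ} {c : Fin (q + 1) → P} (h : StrictMono c) :
    simplexChain K c = Finsupp.single ⟨c, h⟩ 1 := dif_pos h

theorem simplexChain_of_not {q : ℕ} {c : Fin (q + 1) → P} (h : ¬ StrictMono c) :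
    simplexChain K c = 0 := dif_neg h

theorem chainMap_simplexChain (q : ℕ) (f : P →o P) {c : Fin (q + 1) → P} (hc : Monotone c) :
    chainMap K q f (simplexChain K c) = simplexChain K (f ∘ c) := by
  by_cases h : StrictMono c
  · simp [simplexChain_of_strictMono K h, chainMap]
  · rw [simplexChain_of_not K h, map_zero, simplexChain_of_not]
    intro h'
    exact h (hc.strictMono_of_injective (h'.injective.of_comp))

theorem boundary_simplexChain (q : ℕ) {c : Fin (q + 2) → P} (hc : Monotone c) :
    boundary K P q (simplexChain K c) =
      ∑ i : Fin (q + 2), (-1 : K) ^ (i : ℕ) • simplexChain K (c ∘ i.succAbove) := by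
  by_cases h : StrictMono c
  · simp [simplexChain_of_strictMono K h, boundary]
  rw [simplexChain_of_not K h, map_zero]
  obtain ⟨j, hj⟩ : ∃ j : Fin (q + 1), c j.castSucc = c j.succ := by
    by_contra hcon
    push Not at hcon
    exact h (Fin.strictMono_iff_lt_succ.2 fun j =>
      lt_of_le_of_ne (hc (Fin.castSucc_lt_succ).le) (hcon j))
  have hne : j.castSucc ≠ j.succ := (Fin.castSucc_lt_succ).ne
  symm
  rw [Fintype.sum_eq_add j.castSucc j.succ hne]
  · have : c ∘ j.castSucc.succAbove = c ∘ j.succ.succAbove := by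
      funext k
      rcases lt_trichotomy k j with hk | rfl | hk
      · simp only [Function.comp]
        rw [Fin.succAbove_castSucc_of_lt _ _ hk,
          Fin.succAbove_of_castSucc_lt _ _ (Fin.castSucc_lt_succ_iff.2 hk.le)]
      · simp [hj]
      · simp only [Function.comp]
        rw [Fin.succAbove_castSucc_of_le _ _ hk.le, Fin.succAbove_succ_of_lt _ _ hk]
    rw [this]
    simp [pow_succ]
  · rintro i ⟨hi1, hi2⟩
    rw [simplexChain_of_not, smul_zero]
    intro hs
    obtain ⟨a, ha⟩ := Fin.exists_succAbove_eq hi1.symm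
    obtain ⟨b, hb⟩ := Fin.exists_succAbove_eq hi2.symm
    have hab : a = b := hs.injective (by simp [ha, hb, hj])
    rw [hab, hb] at ha
    exact hne ha.symm

theorem boundary_chainMap (q : ℕ) (f : P →o P) (x : Chains K P (q + 1)) :
    boundary K P q (chainMap K (q + 1) f x) = chainMap K q f (boundary K P q x) := by
  suffices h : boundary K P q ∘ₗ chainMap K (q + 1) f = chainMap K q f ∘ₗ boundary K P q from
    LinearMap.congr_fun h x
  ext1 c
  ext1
  have hm : Monotone c.1 := c.2.monotone
  simp only [LinearMap.comp_apply, Finsupp.lsingle_apply, ← simplexChain_of_strictMono K c.2]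
  rw [chainMap_simplexChain K _ _ hm, boundary_simplexChain K _ hm,
    boundary_simplexChain K _ (f.monotone.comp hm), map_sum]
  refine Finset.sum_congr rfl fun i _ => ?_
  rw [map_smul, chainMap_simplexChain K _ _ (hm.comp (Fin.strictMono_succAbove i).monotone)]
  rfl

theorem augmentation_chainMap (f : P →o P) (x : Chains K P 0) :
    augmentation K P (chainMap K 0 f x) = augmentation K P x := by
  suffices h : augmentation K P ∘ₗ chainMap K 0 f = augmentation K P from LinearMap.congr_fun h x
  ext1 c
  ext1
  have h : StrictMono (f ∘ c.1) := fun i j hij => by omega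
  simp [chainMap, augmentation, simplexChain_of_strictMono K h]

variable {N : Type*} [Monoid N]

/-- The representation of a monoid `N` on `C_q(Δ(P), K)` induced by an action of `N` on `P` by order
preserving maps. -/
noncomputable def chainRep (q : ℕ) (a : N →* (P →o P)) : Representation K N (Chains K P q) where
  toFun m := chainMap K q (a m)
  map_one' := by
    ext1 c
    ext1
    simp only [LinearMap.comp_apply, Finsupp.lsingle_apply, ← simplexChain_of_strictMono K c.2]
    rw [chainMap_simplexChain K _ _ c.2.monotone, map_one]
    rfl
  map_mul' m n := by
    ext1 c
    ext1
    have hm : Monotone c.1 := c.2.monotone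
    simp only [LinearMap.comp_apply, Module.End.mul_apply, Finsupp.lsingle_apply,
      ← simplexChain_of_strictMono K c.2]
    rw [chainMap_simplexChain K _ _ hm, chainMap_simplexChain K _ _ hm,
      chainMap_simplexChain K _ _ ((a n).monotone.comp hm), map_mul]
    rfl

/-- The boundary as a homomorphism of representations. -/
noncomputable def boundaryHom (q : ℕ) (a : N →* (P →o P)) :
    (chainRep K (q + 1) a).IntertwiningMap (chainRep K q a) where
  toLinearMap := boundary K P q
  isIntertwining' m := LinearMap.ext fun x => boundary_chainMap K q (a m) x

/-- The augmentation as a homomorphism to the trivial representation. -/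
noncomputable def augmentationHom (a : N →* (P →o P)) :
    (chainRep K 0 a).IntertwiningMap (Representation.trivial K N K) where
  toLinearMap := augmentation K P
  isIntertwining' m := LinearMap.ext fun x => augmentation_chainMap K (a m) x

end Chains

/-! ### Inflation from `K M_{≥X}` to `K M` -/

section Inflation

variable {M : Type*} [Monoid M] [IsLeftDuo M] [Finite M] [IsRegularMonoid M]
variable (K : Type*) [Field K]

open Classical in
/-- The algebra homomorphism `ρ_X : KM → K M_{≥X}` which sends `m` to `m` if `m ∈ M_{≥X}`, and to
`0` otherwise. -/
noncomputable def rhoX (X : Lam M) : K[M] →ₐ[K] K[contraction X] :=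
  MonoidAlgebra.lift K K[contraction X] M
    { toFun := fun m => if h : m ∈ contraction X then MonoidAlgebra.single ⟨m, h⟩ 1 else 0
      map_one' := by
        rw [dif_pos (contraction X).one_mem]
        rfl
      map_mul' := fun m n => by
        by_cases hm : m ∈ contraction X
        · by_cases hn : n ∈ contraction X
          · rw [dif_pos hm, dif_pos hn, dif_pos (mul_mem_contraction.2 ⟨hm, hn⟩),
              MonoidAlgebra.single_mul_single, mul_one]
            rfl
          · rw [dif_neg hn, dif_neg (fun h => hn (mul_mem_contraction.1 h).2), mul_zero]
        · rw [dif_neg hm, dif_neg (fun h => hm (mul_mem_contraction.1 h).1), zero_mul] }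

variable {K}
variable {W W' : Type*} [AddCommMonoid W] [Module K W] [AddCommMonoid W'] [Module K W']

/-- The inflation along `ρ_X` of a `K M_{≥X}`-module to a `KM`-module, as a representation of `M`:
`m` acts as `ρ_X(m)`. -/
noncomputable def inflate {X : Lam M} (ρ : Representation K (contraction X) W) :
    Representation K M W :=
  ((ρ.asAlgebraHom.comp (rhoX K X) : K[M] →ₐ[K] Module.End K W) : K[M] →* Module.End K W).comp
    (MonoidAlgebra.of K M)

/-- A `K M_{≥X}`-linear map, as a `KM`-linear map of inflated modules. -/
noncomputable def inflateMap {X : Lam M} {ρ : Representation K (contraction X) W}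
    {ρ' : Representation K (contraction X) W'} (f : ρ.IntertwiningMap ρ') :
    (inflate ρ).asModule →ₗ[K[M]] (inflate ρ').asModule :=
  Representation.IntertwiningMap.equivLinearMapAsModule _ _
    { toLinearMap := f.toLinearMap
      isIntertwining' := fun m => by
        by_cases h : m ∈ contraction X
        · simpa [inflate, rhoX, h] using f.isIntertwining' ⟨m, h⟩
        · simp [inflate, rhoX, h] }

end Inflation

/-! ### The complex `C_•(Δ(B_{≥X}), K) ⊗ V → V` -/

section Resolution

variable {M : Type*} [Monoid M] [IsLeftDuo M] [Finite M] [IsRegularMonoid M]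
variable {K : Type*} [Field K] {V : Type*} [AddCommGroup V] [Module K V]
variable {X : Lam M} (e : Idem M) (he : sigma (e : M) = X)
variable (τ : Representation K (MaxSubgroup e) V)

/-- `V` as a `K M_{≥X}`-module, via the homomorphism `M_{≥X} → G_X`. -/
noncomputable def contractionRep : Representation K (contraction X) V :=
  τ.comp (toMaxSubgroup e he)

/-- `V` as a `KM`-module. -/
abbrev InflatedModule : Type _ := (inflate (contractionRep e he τ)).asModule

/-- The `KM`-module `C_q(Δ(B_{≥X}), K) ⊗ V`: the tensor product of `K M_{≥X}`-modules, inflated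
to `KM`. -/
abbrev ResolutionModule (q : ℕ) : Type _ :=
  (inflate ((chainRep K q (actHom X)).tprod (contractionRep e he τ))).asModule

/-- The differential `∂ ⊗ id`. -/
noncomputable def resolutionD (q : ℕ) :
    ResolutionModule e he τ (q + 1) →ₗ[K[M]] ResolutionModule e he τ q :=
  inflateMap ((boundaryHom K q (actHom X)).rTensor (contractionRep e he τ))

/-- The augmentation `ε ⊗ id : C_0(Δ(B_{≥X}), K) ⊗ V → K ⊗ V = V`. -/
noncomputable def resolutionAug : ResolutionModule e he τ 0 →ₗ[K[M]] InflatedModule e he τ :=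
  inflateMap ((Representation.TensorProduct.lid K (contractionRep e he τ)).toIntertwiningMap.comp
    ((augmentationHom K (actHom X)).rTensor (contractionRep e he τ)))

end Resolution

/-- `⋯ → C 1 → C 0 → V → 0` is a projective resolution of the `R`-module `V`. -/
structure IsProjectiveResolution {R : Type*} [Ring R] {C : ℕ → Type*}
    [∀ q, AddCommMonoid (C q)] [∀ q, Module R (C q)] {V : Type*} [AddCommMonoid V] [Module R V]
    (d : ∀ q, C (q + 1) →ₗ[R] C q) (ε : C 0 →ₗ[R] V) : Prop where
  projective : ∀ q, Module.Projective R (C q)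
  exact_succ : ∀ q, Function.Exact (d (q + 1)) (d q)
  exact_zero : Function.Exact (d 0) ε
  surjective : Function.Surjective ε

end LeftDuo

open LeftDuo

/-! Exactness. The identity of `M` is the greatest element of $B_{\ge X}$, so $\Delta(B_{\ge X})$ is
a cone. Appending the cone point to chains contracts the augmented chain complex
(`boundary_coneMap`, `boundary_coneMap_zero`), and tensoring with `V` over a field preserves
exactness.

Projectivity. Put $W = C_q \otimes V$. It suffices to split the action map $KM \otimes W \to W$,
whose source is free over $KM$. Filter `W` by the size of $Bf$, where `f` is the largest vertex of a
chain, and put $Y = \sigma(f)$. If $m \in M_{\ge Y}$, then `m` keeps the chain strict and preserves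
the value of $\sigma$ at its top; any other `m` kills the chain or strictly lowers that value
(`act_injOn`, `sigma_act_eq_iff`). Hence elements outside $M_{\ge Y}$ act as zero on the layer.

The splitting on a layer is $w \mapsto |G|^{-1} \sum_g f g \theta \otimes g^{-1} w$, with `G` a
maximal subgroup belonging to `Y`. Here $\theta \in KM$ satisfies $m\theta = 0$ for $m \notin M_{\ge
Y}$ and is congruent to 1 modulo the span of such `m` (`exists_annihilator`). Averaging gives
equivariance (`average_act`); the congruence gives a section up to lower terms
(`exists_actionMap_average_eq`). `projective_of_filtration` combines the layers. -/

namespace LeftDuo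

/-! ### Order complexes with a greatest vertex are acyclic -/

section Cone

variable (K : Type*) [Field K] {P : Type*} [PartialOrder P]

theorem augmentation_simplexChain (c : Fin 1 → P) :
    augmentation K P (simplexChain K c) = 1 := by
  have h : StrictMono c := fun i j hij => by omega
  simp [simplexChain_of_strictMono K h, augmentation]

theorem boundary_boundary (q : ℕ) (x : Chains K P (q + 2)) :
    boundary K P q (boundary K P (q + 1) x) = 0 := by
  suffices h : boundary K P q ∘ₗ boundary K P (q + 1) = 0 from LinearMap.congr_fun h x
  ext1 c
  ext1
  have hm : Monotone c.1 := c.2.monotone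
  simp only [LinearMap.comp_apply, Finsupp.lsingle_apply, ← simplexChain_of_strictMono K c.2,
    LinearMap.zero_apply]
  rw [boundary_simplexChain K _ hm, map_sum]
  simp only [map_smul, boundary_simplexChain K _
    (hm.comp (Fin.strictMono_succAbove _).monotone), Finset.smul_sum, smul_smul, ← pow_add]
  rw [← Finset.sum_product', Finset.univ_product_univ]
  -- The involution deletes the same two vertices in the other order, which reverses the sign.
  refine Finset.sum_involution (fun p _ => (p.1.succAbove p.2, p.2.predAbove p.1)) ?_ ?_ ?_ ?_
  · rintro ⟨i, j⟩ -
    dsimp only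
    rw [Fin.neg_one_pow_succAbove_add_predAbove]
    have : (c.1 ∘ (i.succAbove j).succAbove) ∘ (j.predAbove i).succAbove =
        (c.1 ∘ i.succAbove) ∘ j.succAbove := by
      funext k
      simp [Fin.succAbove_succAbove_succAbove_predAbove]
    rw [this, neg_smul, add_neg_cancel]
  · rintro ⟨i, j⟩ - - h
    exact Fin.succAbove_ne i j (Prod.ext_iff.1 h).1
  · intros; exact Finset.mem_univ _
  · rintro ⟨i, j⟩ -
    simp [Fin.succAbove_succAbove_predAbove, Fin.predAbove_predAbove_succAbove]

variable [OrderTop P]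

/-- Adjoining the top element of `P` to chains: the contraction of the cone `Δ(P)`. -/
noncomputable def coneMap (q : ℕ) : Chains K P q →ₗ[K] Chains K P (q + 1) :=
  Finsupp.linearCombination K fun c => simplexChain K (Fin.snoc (α := fun _ => P) c.1 ⊤)

theorem monotone_snoc_top {q : ℕ} {c : Fin (q + 1) → P} (hc : Monotone c) :
    Monotone (Fin.snoc (α := fun _ => P) c ⊤) := by
  intro i j hij
  induction j using Fin.lastCases with
  | last => simp
  | cast j =>
    induction i using Fin.lastCases with
    | last => exact absurd hij (not_le.2 (Fin.castSucc_lt_last j))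
    | cast i => simpa using hc (Fin.castSucc_le_castSucc_iff.1 hij)

theorem coneMap_simplexChain (q : ℕ) {c : Fin (q + 1) → P} :
    coneMap K q (simplexChain K c) = simplexChain K (Fin.snoc (α := fun _ => P) c ⊤) := by
  by_cases h : StrictMono c
  · simp [simplexChain_of_strictMono K h, coneMap]
  · rw [simplexChain_of_not K h, map_zero, simplexChain_of_not]
    intro h'
    refine h fun i j hij => ?_
    simpa using h' (Fin.castSucc_lt_castSucc_iff.2 hij)

/-- Deleting the appended `⊤` returns the chain with sign $(-1)^{q+2}$; every other face is the cone
over a face. A chain already ending in `⊤` has degenerate cone, but `boundary_simplexChain` covers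
weakly increasing sequences, so no case distinction arises. -/
theorem boundary_coneMap (q : ℕ) (x : Chains K P (q + 1)) :
    boundary K P (q + 1) (coneMap K (q + 1) x) =
      coneMap K q (boundary K P q x) + (-1 : K) ^ q • x := by
  suffices h : boundary K P (q + 1) ∘ₗ coneMap K (q + 1) =
      coneMap K q ∘ₗ boundary K P q + (-1 : K) ^ q • LinearMap.id from LinearMap.congr_fun h x
  ext1 c
  ext1
  have hm : Monotone c.1 := c.2.monotone
  simp only [LinearMap.comp_apply, Finsupp.lsingle_apply, ← simplexChain_of_strictMono K c.2,
    LinearMap.add_apply, LinearMap.smul_apply, LinearMap.id_apply]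
  rw [coneMap_simplexChain, boundary_simplexChain K _ (monotone_snoc_top hm),
    boundary_simplexChain K _ hm, Fin.sum_univ_castSucc, map_sum]
  congr 1
  · refine Finset.sum_congr rfl fun i _ => ?_
    rw [map_smul, coneMap_simplexChain, Fin.val_castSucc]
    congr 2
    funext k
    induction k using Fin.lastCases with
    | last => simp
    | cast k =>
      rw [Function.comp_apply, Fin.castSucc_succAbove_castSucc]
      simp
  · rw [Fin.val_last, pow_add _ q 2, neg_one_sq, mul_one]
    congr 2
    · funext k
      simp [Fin.succAbove_last]

theorem boundary_coneMap_zero (x : Chains K P 0) :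
    boundary K P 0 (coneMap K 0 x) =
      augmentation K P x • simplexChain K (fun _ => ⊤) - x := by
  suffices h : boundary K P 0 ∘ₗ coneMap K 0 =
      (augmentation K P).smulRight (simplexChain K (fun _ => ⊤)) - LinearMap.id from
    LinearMap.congr_fun h x
  ext1 c
  ext1
  have hm : Monotone c.1 := c.2.monotone
  simp only [LinearMap.comp_apply, Finsupp.lsingle_apply, ← simplexChain_of_strictMono K c.2,
    LinearMap.sub_apply, LinearMap.smulRight_apply, LinearMap.id_apply]
  rw [coneMap_simplexChain, boundary_simplexChain K _ (monotone_snoc_top hm),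
    augmentation_simplexChain,
    Fin.sum_univ_two, one_smul]
  have h0 : (Fin.snoc (α := fun _ => P) c.1 ⊤) ∘ (0 : Fin 2).succAbove = fun _ => ⊤ := by
    funext k
    obtain rfl : k = 0 := Subsingleton.elim _ _
    exact Fin.snoc_last (α := fun _ => P) _ _
  have h1 : (Fin.snoc (α := fun _ => P) c.1 ⊤) ∘ (1 : Fin 2).succAbove = c.1 := by
    funext k
    obtain rfl : k = 0 := Subsingleton.elim _ _
    exact Fin.snoc_castSucc (α := fun _ => P) _ _ _
  rw [h0, h1]
  simp [sub_eq_add_neg]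

theorem boundary_exact (q : ℕ) :
    Function.Exact (boundary K P (q + 1)) (boundary K P q) := by
  intro x
  constructor
  · intro hx
    refine ⟨(-1 : K) ^ q • coneMap K (q + 1) x, ?_⟩
    rw [map_smul, boundary_coneMap, hx, map_zero, zero_add, smul_smul, ← mul_pow]
    simp
  · rintro ⟨y, rfl⟩
    exact boundary_boundary K q y

theorem augmentation_exact : Function.Exact (boundary K P 0) (augmentation K P) := by
  intro x
  constructor
  · intro hx
    refine ⟨-coneMap K 0 x, ?_⟩
    rw [map_neg, boundary_coneMap_zero, hx, zero_smul, zero_sub, neg_neg]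
  · rintro ⟨y, rfl⟩
    suffices h : augmentation K P ∘ₗ boundary K P 0 = 0 from LinearMap.congr_fun h y
    ext1 c
    ext1
    simp only [LinearMap.comp_apply, Finsupp.lsingle_apply, ← simplexChain_of_strictMono K c.2]
    rw [boundary_simplexChain K _ c.2.monotone, Fin.sum_univ_two]
    simp [augmentation_simplexChain]

theorem augmentation_surjective : Function.Surjective (augmentation K P) := fun a =>
  ⟨a • simplexChain K fun _ => ⊤, by simp [augmentation_simplexChain]⟩

end Cone

/-! ### Exactness of the augmented complex -/

section Exactness

variable {M : Type*} [Monoid M] [IsLeftDuo M] [Finite M] [IsRegularMonoid M]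
variable {K : Type*} [Field K] {V : Type*} [AddCommGroup V] [Module K V]
variable {X : Lam M} (e : Idem M) (he : sigma (e : M) = X)
variable (τ : Representation K (MaxSubgroup e) V)

/-- The cone point: 1 lies in every $M_{\ge X}$. -/
noncomputable instance : OrderTop (IdemGE X) where
  top := ⟨1, (contraction X).one_mem⟩
  le_top f := (Idem.le_iff (e := f.1) (f := 1)).2 (one_mul _)

/-- Inflation does not change the underlying linear maps, so this is flatness of `V` over `K`. -/
theorem resolutionD_exact (q : ℕ) :
    Function.Exact (resolutionD e he τ (q + 1)) (resolutionD e he τ q) :=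
  Module.Flat.rTensor_exact V (boundary_exact K (P := IdemGE X) q)

theorem resolutionAug_apply (x : ResolutionModule e he τ 0) :
    resolutionAug e he τ x =
      TensorProduct.lid K V ((augmentation K (IdemGE X)).rTensor V x) := rfl

theorem resolutionAug_exact :
    Function.Exact (resolutionD e he τ 0) (resolutionAug e he τ) := by
  intro x
  rw [resolutionAug_apply]
  refine (EmbeddingLike.map_eq_zero_iff).trans ?_
  exact Module.Flat.rTensor_exact V (augmentation_exact K (P := IdemGE X)) x

theorem resolutionAug_surjective : Function.Surjective (resolutionAug e he τ) :=
  (TensorProduct.lid K V).surjective.comp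
    (LinearMap.rTensor_surjective V (augmentation_surjective K (P := IdemGE X)))

end Exactness

/-! ### How the action on idempotents changes $\sigma$ -/

section Support

variable {M : Type*} [Monoid M]

instance [Finite M] : Finite (Idem M) := Finite.of_injective Idem.val fun _ _ => Idem.ext

theorem Idem.pow_eq (f : Idem M) {n : ℕ} (hn : 0 < n) : (f : M) ^ n = f := by
  obtain ⟨k, rfl⟩ := Nat.exists_eq_add_of_lt hn
  rw [zero_add]
  exact f.isIdem.pow_succ_eq k

theorem omega_idem [Finite M] (f : Idem M) : omega (f : M) = f :=
  Idem.ext (f.pow_eq (omegaExp_pos _))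

theorem dagger_idem [Finite M] (f : Idem M) : dagger (f : M) = f :=
  f.pow_eq (by have := omegaExp_pos (f : M); omega)

variable [IsLeftDuo M] [Finite M]

theorem coe_sigma_idem (f : Idem M) : (sigma (f : M)).1 = leftIdeal f :=
  congrArg leftIdeal (omega_idem f)

theorem sigma_le_iff {f g : Idem M} : sigma (f : M) ≤ sigma (g : M) ↔ (f : M) * g = f := by
  rw [← Subtype.coe_le_coe, coe_sigma_idem, coe_sigma_idem]
  exact leftIdeal_subset_iff

/-- The number of elements of the left ideal `Bf`. -/
noncomputable def rank (f : Idem M) : ℕ := (leftIdeal f).ncard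

theorem rank_lt {f g : Idem M} (h : sigma (f : M) < sigma (g : M)) : rank f < rank g := by
  rw [← Subtype.coe_lt_coe, coe_sigma_idem, coe_sigma_idem] at h
  exact Set.ncard_lt_ncard h

theorem rank_eq {f g : Idem M} (h : sigma (f : M) = sigma (g : M)) : rank f = rank g := by
  rw [rank, rank, ← coe_sigma_idem, ← coe_sigma_idem, h]

/-- A chosen idempotent `f` with `Bf = Y`. -/
noncomputable def Lam.rep (Y : Lam M) : Idem M := Y.2.choose

theorem Lam.sigma_rep (Y : Lam M) : sigma (Y.rep : M) = Y := by
  exact Subtype.ext ((coe_sigma_idem _).trans Y.2.choose_spec)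

variable [IsRegularMonoid M]

theorem mem_contraction_sigma {f : Idem M} {m : M} :
    m ∈ contraction (sigma (f : M)) ↔ ∃ x : M, (f : M) = x * m := by
  rw [mem_contraction, ← Subtype.coe_le_coe, coe_sigma_idem]
  exact le_sigma_iff f m

theorem act_mul_right (m : M) (f : Idem M) : (act m f : M) * f = act m f := by
  obtain ⟨y, hy⟩ := IsLeftDuo.exists_mul_eq_mul (f : M) (dagger m)
  rw [act_coe, mul_assoc m, hy]
  simp only [mul_assoc, f.mul_self]

theorem sigma_act_le (m : M) (f : Idem M) : sigma (act m f : M) ≤ sigma (f : M) :=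
  sigma_le_iff.2 (act_mul_right m f)

theorem mul_act_self (m : M) (f : Idem M) : (f : M) * act m f = f * omega m := by
  rw [act_coe, ← mul_assoc, ← mul_assoc, idem_mul_mul, mul_assoc, mul_dagger]

theorem mul_omega_of_mem {f : Idem M} {m : M} (h : m ∈ contraction (sigma (f : M))) :
    (f : M) * omega m = f := by
  obtain ⟨x, hx⟩ := mem_contraction_sigma.1 h
  rw [hx, mul_assoc, mul_omega_self]

/-- As `act` never raises $\sigma$, equality amounts to $f \cdot mfm^\dagger = f$. The left side is
$f m^\omega$ by `mul_act_self`, and $f m^\omega = f$ says that `f` lies in $Mm$. -/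
theorem sigma_act_eq_iff {m : M} {f : Idem M} :
    sigma (act m f : M) = sigma (f : M) ↔ m ∈ contraction (sigma (f : M)) := by
  constructor
  · intro h
    have h1 := sigma_le_iff.1 h.ge
    rw [mul_act_self] at h1
    refine mem_contraction_sigma.2 ⟨f * dagger m, ?_⟩
    rw [mul_assoc, dagger_mul, h1]
  · intro h
    exact le_antisymm (sigma_act_le m f) (sigma_le_iff.2 (by rw [mul_act_self, mul_omega_of_mem h]))

/-- Left multiplication by $f m^\dagger$ undoes multiplication by `m` below `f`: $f m^\dagger m r =
f m^\omega r = f r = r$. This is why chains with top `f` do not collapse. -/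
theorem act_injOn {m : M} {f p p' : Idem M} (h : m ∈ contraction (sigma (f : M)))
    (hp : p ≤ f) (hp' : p' ≤ f) (heq : act m p = act m p') : p = p' := by
  have h1 : m * (p : M) = m * p' := by rw [← act_mul_self, heq, act_mul_self]
  have h2 : ∀ r : Idem M, r ≤ f → (r : M) = f * dagger m * (m * r) := fun r hr => by
    rw [mul_assoc, ← mul_assoc (dagger m), dagger_mul, ← mul_assoc, mul_omega_of_mem h]
    exact (Idem.le_iff.1 hr).symm
  exact Idem.ext (by rw [h2 p hp, h2 p' hp', h1])

theorem act_idem_of_le {f p : Idem M} (h : p ≤ f) : act (f : M) p = p := by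
  apply Idem.ext
  rw [act_coe, dagger_idem, idem_mul_mul]
  exact Idem.le_iff.1 h

theorem rank_act_le (m : M) (f : Idem M) : rank (act m f) ≤ rank f := by
  rcases (sigma_act_le m f).lt_or_eq with h | h
  · exact (rank_lt h).le
  · exact (rank_eq h).le

theorem rank_act_lt {m : M} {f : Idem M} (h : m ∉ contraction (sigma (f : M))) :
    rank (act m f) < rank f :=
  rank_lt ((sigma_act_le m f).lt_of_ne fun h' => h (sigma_act_eq_iff.1 h'))

end Support

/-! ### The element $\theta$ attached to $Y$ -/

section Annihilator

section

variable {K : Type*} [Field K] {M : Type*} [Monoid M]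

/-- Left duo gives $mn = ym$, so right multiplication by `e` fixes all of $mM$ as soon as it fixes
`m`. -/
theorem of_mul_mul_one_sub_eq_zero [IsLeftDuo M] {m : M} {e : Idem M} (h : m * e = m) (x : K[M]) :
    MonoidAlgebra.of K M m * x * (1 - MonoidAlgebra.of K M e) = 0 := by
  induction x using MonoidAlgebra.induction_linear with
  | zero => simp
  | add x y hx hy => rw [mul_add, add_mul, hx, hy, add_zero]
  | single n a =>
    obtain ⟨y, hy⟩ := IsLeftDuo.exists_mul_eq_mul m n
    have : m * n * e = m * n := by rw [hy, mul_assoc, h]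
    simp [MonoidAlgebra.single_mul_single, mul_sub, this]

end

variable (K : Type*) [Field K] {M : Type*} [Monoid M] [IsLeftDuo M] [Finite M] [IsRegularMonoid M]

/-- The span of the complement of `M_{≥Y}`, an ideal of `KM`. -/
noncomputable def complementSpan (Y : Lam M) : Submodule K K[M] :=
  Submodule.span K (MonoidAlgebra.of K M '' {m | m ∉ contraction Y})

variable {K}

theorem of_mul_mem_complementSpan {Y : Lam M} {m : M} (hm : m ∉ contraction Y) (x : K[M]) :
    MonoidAlgebra.of K M m * x ∈ complementSpan K Y := by
  induction x using MonoidAlgebra.induction_linear with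
  | zero => simp
  | add x y hx hy => rw [mul_add]; exact add_mem hx hy
  | single n a =>
    have : MonoidAlgebra.of K M m * MonoidAlgebra.single n a =
        a • MonoidAlgebra.of K M (m * n) := by
      simp [MonoidAlgebra.single_mul_single, MonoidAlgebra.smul_single]
    rw [this]
    exact Submodule.smul_mem _ _ (Submodule.subset_span
      ⟨_, fun h => hm (mul_mem_contraction.1 h).1, rfl⟩)

variable (K) in
/-- The span of the complement of `M_{≥Y}` has a right identity, here written `1 - θ`. -/
theorem exists_annihilator (Y : Lam M) : ∃ θ : K[M],
    (∀ m ∉ contraction Y, MonoidAlgebra.of K M m * θ = 0) ∧ θ - 1 ∈ complementSpan K Y := by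
  -- $\theta$ is the product of the factors $1 - f$ over `L`. The arbitrary `x` absorbs the factors
  -- to the left of the one that `m` kills, so the order of the product is immaterial.
  have key : ∀ L : List (Idem M), (∀ f ∈ L, (f : M) ∉ contraction Y) → ∃ θ : K[M],
      (∀ f ∈ L, ∀ m : M, m * f = m → ∀ x : K[M], MonoidAlgebra.of K M m * x * θ = 0) ∧
        θ - 1 ∈ complementSpan K Y := by
    intro L
    induction L with
    | nil => exact fun _ => ⟨1, by simp⟩
    | cons d L ih =>
      intro hL
      obtain ⟨θ, h1, h2⟩ := ih fun f hf => hL f (List.mem_cons_of_mem _ hf)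
      refine ⟨(1 - MonoidAlgebra.of K M d) * θ, ?_, ?_⟩
      · intro f hf m hm x
        rcases List.mem_cons.1 hf with rfl | hf
        · rw [← mul_assoc, of_mul_mul_one_sub_eq_zero hm, zero_mul]
        · rw [← mul_assoc, mul_assoc _ x]
          exact h1 f hf m hm _
      · rw [sub_mul, one_mul, sub_right_comm]
        exact sub_mem h2 (of_mul_mem_complementSpan (hL d List.mem_cons_self) θ)
  classical
  have := Fintype.ofFinite (Idem M)
  obtain ⟨θ, h1, h2⟩ := key
    (Finset.univ.filter fun f : Idem M => (f : M) ∉ contraction Y).toList (by simp)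
  refine ⟨θ, fun m hm => ?_, h2⟩
  -- The factor killed by `m` is the one for $m^\omega$, which has the same $\sigma$ as `m` and
  -- satisfies $m m^\omega = m$.
  have hω : (omega m : M) ∉ contraction Y := by
    rw [mem_contraction, ← Subtype.coe_le_coe, coe_sigma_idem]
    exact hm
  simpa using h1 (omega m) (by simpa using hω) m (mul_omega_self m) 1

end Annihilator

/-! ### Projectivity from splittings on the layers of a filtration -/

section Projective

variable {K : Type*} [Field K] {M : Type*} [Monoid M] {W : Type*} [AddCommMonoid W] [Module K W]

variable (K) in
theorem add_neg_one_smul (x : W) : x + (-1 : K) • x = 0 := by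
  nth_rw 1 [← one_smul K x]
  rw [← add_smul, add_neg_cancel, zero_smul]

/-- The action map `KM ⊗ W → W`. -/
noncomputable def actionMap (ρ : Representation K M W) : K[M] ⊗[K] W →ₗ[K] W :=
  TensorProduct.lift ρ.asAlgebraHom.toLinearMap

theorem actionMap_tmul (ρ : Representation K M W) (x : K[M]) (w : W) :
    actionMap ρ (x ⊗ₜ w) = ρ.asAlgebraHom x w := rfl

theorem actionMap_smul (ρ : Representation K M W) (m : M) (z : K[M] ⊗[K] W) :
    actionMap ρ (MonoidAlgebra.of K M m • z) = ρ m (actionMap ρ z) := by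
  induction z with
  | zero => simp
  | add x y hx hy => rw [smul_add, map_add, hx, hy, map_add, map_add]
  | tmul x w =>
    rw [TensorProduct.smul_tmul', actionMap_tmul, smul_eq_mul, map_mul,
      Representation.asAlgebraHom_of, actionMap_tmul]
    rfl

/-- A representation is projective if it has a filtration such that the action map is split
on each layer. -/
theorem projective_of_filtration [Module.Free K W] (ρ : Representation K M W) (U : ℕ → Submodule K W)
    (h0 : U 0 = ⊥) (N : ℕ) (hN : U N = ⊤)
    (h : ∀ n, ∃ s : W →ₗ[K] K[M] ⊗[K] W, ∀ w ∈ U (n + 1),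
      (∀ m, s (ρ m w) = MonoidAlgebra.of K M m • s w) ∧ ∃ u ∈ U n, actionMap ρ (s w) = w + u) :
    Module.Projective K[M] ρ.asModule := by
  have key : ∀ n, ∃ s : W →ₗ[K] K[M] ⊗[K] W, ∀ w ∈ U n,
      (∀ m, s (ρ m w) = MonoidAlgebra.of K M m • s w) ∧ actionMap ρ (s w) = w := by
    intro n
    induction n with
    | zero =>
      refine ⟨0, fun w hw => ?_⟩
      rw [h0, Submodule.mem_bot] at hw
      simp [hw]
    | succ n ih =>
      obtain ⟨s, hs⟩ := ih
      obtain ⟨s', hs'⟩ := h n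
      -- The layer map `s'` is a section up to an error in `U n`, which the section `s` on `U n`
      -- corrects. Equivariance of the correction is needed only at the error term, so the `U n`
      -- need not be assumed stable under `M`.
      refine ⟨s' + s ∘ₗ (LinearMap.id + (-1 : K) • actionMap ρ ∘ₗ s'), fun w hw => ?_⟩
      obtain ⟨h1, u, hu, h2⟩ := hs' w hw
      obtain ⟨h3, h4⟩ := hs _ (Submodule.smul_mem _ (-1) hu)
      have hw' : w + (-1 : K) • actionMap ρ (s' w) = (-1 : K) • u := by
        rw [h2, smul_add, ← add_assoc, add_neg_one_smul K, zero_add]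
      simp only [LinearMap.add_apply, LinearMap.comp_apply, LinearMap.smul_apply,
        LinearMap.id_apply]
      constructor
      · intro m
        rw [h1, actionMap_smul, ← map_smul (ρ m), ← map_add (ρ m), hw', h3, smul_add]
      · rw [hw', map_add, h4, h2, add_assoc, add_neg_one_smul K, add_zero]
  obtain ⟨s, hs⟩ := key N
  simp only [hN, Submodule.mem_top, forall_const] at hs
  let S : ρ.asModule →ₗ[K[M]] K[M] ⊗[K] W :=
    MonoidAlgebra.equivariantOfLinearOfComm (s ∘ₗ ρ.asModuleEquiv.toLinearMap) fun m w => by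
      have := (hs (ρ.asModuleEquiv w)).1 m
      rw [Representation.single_smul, one_smul]
      exact this
  let p : K[M] ⊗[K] W →ₗ[K[M]] ρ.asModule :=
    MonoidAlgebra.equivariantOfLinearOfComm (ρ.asModuleEquiv.symm.toLinearMap ∘ₗ actionMap ρ)
      fun m z => by
        have := actionMap_smul ρ m z
        rw [Representation.single_smul, one_smul]
        exact this
  -- `M` acts on the left factor of $KM \otimes W$ only, so that module is free; `S` makes
  -- `ρ.asModule` a direct summand.
  exact Module.Projective.of_split S p (LinearMap.ext fun w => (hs w).2)

end Projective

/-! ### Group laws of a maximal subgroup, read in $M$ -/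

section MaximalSubgroup

variable {M : Type*} [Monoid M]

noncomputable instance [Finite M] (e : Idem M) : Fintype (MaxSubgroup e) := Fintype.ofFinite _

theorem MaxSubgroup.val_mul {e : Idem M} (g h : MaxSubgroup e) :
    (g * h).val.val = g.val.val * h.val.val := rfl

theorem MaxSubgroup.val_mul_inv {e : Idem M} (g : MaxSubgroup e) :
    g.val.val * (g⁻¹).val.val = e := congrArg LocalMonoid.val g.mul_inv

theorem MaxSubgroup.val_inv_mul {e : Idem M} (g : MaxSubgroup e) :
    (g⁻¹).val.val * g.val.val = e := congrArg LocalMonoid.val g.inv_mul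

end MaximalSubgroup

/-! ### The averaged splitting on one layer -/

section Average

variable {K : Type*} [Field K] {M : Type*} [Monoid M] [IsLeftDuo M] [Finite M] [IsRegularMonoid M]
variable {W : Type*} [AddCommMonoid W] [Module K W] (ρ : Representation K M W)

variable (K) in
/-- An element `θ ∈ KM` such that `mθ = 0` for `m ∉ M_{≥Y}`, and `θ = 1` modulo such `m`. -/
noncomputable def annihilator (Y : Lam M) : K[M] := (exists_annihilator K Y).choose

theorem of_mul_annihilator {Y : Lam M} {m : M} (hm : m ∉ contraction Y) :
    MonoidAlgebra.of K M m * annihilator K Y = 0 :=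
  (exists_annihilator K Y).choose_spec.1 m hm

theorem annihilator_sub_one_mem (Y : Lam M) : annihilator K Y - 1 ∈ complementSpan K Y :=
  (exists_annihilator K Y).choose_spec.2

theorem of_mul_mul_of_mem_complementSpan {Y : Lam M} (a b : M) {x : K[M]}
    (hx : x ∈ complementSpan K Y) :
    MonoidAlgebra.of K M a * x * MonoidAlgebra.of K M b ∈ complementSpan K Y := by
  induction hx using Submodule.span_induction with
  | mem x hx =>
    obtain ⟨m, hm, rfl⟩ := hx
    rw [← map_mul, ← map_mul]
    exact Submodule.subset_span ⟨_, fun h =>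
      hm (mul_mem_contraction.1 (mul_mem_contraction.1 h).1).2, rfl⟩
  | zero => simp
  | add x y _ _ hx hy => rw [mul_add, add_mul]; exact add_mem hx hy
  | smul a x _ hx => rw [mul_smul_comm, smul_mul_assoc]; exact Submodule.smul_mem _ _ hx

theorem asAlgebraHom_mem_of_mem_complementSpan {Y : Lam M} {U : Submodule K W} {w : W}
    (hU : ∀ m ∉ contraction Y, ρ m w ∈ U) {x : K[M]} (hx : x ∈ complementSpan K Y) :
    ρ.asAlgebraHom x w ∈ U := by
  induction hx using Submodule.span_induction with
  | mem x hx =>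
    obtain ⟨m, hm, rfl⟩ := hx
    rw [Representation.asAlgebraHom_of]
    exact hU m hm
  | zero => simp
  | add x y _ _ hx hy => rw [map_add]; exact add_mem hx hy
  | smul a x _ hx => rw [map_smul]; exact Submodule.smul_mem _ _ hx

/-- The map `w ↦ |G|⁻¹ ∑ g, f g θ ⊗ g⁻¹ w`, where `g` runs over the maximal subgroup at the chosen
idempotent of `Y`. -/
noncomputable def average (Y : Lam M) (f : Idem M) : W →ₗ[K] K[M] ⊗[K] W :=
  (Nat.card (MaxSubgroup Y.rep) : K)⁻¹ • ∑ g : MaxSubgroup Y.rep,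
    TensorProduct.mk K K[M] W (MonoidAlgebra.of K M (f * g.val.val) * annihilator K Y) ∘ₗ
      ρ (g⁻¹).val.val

/-- Each $mfg$ stays outside $M_{\ge Y}$, so $\theta$ annihilates it. This matches the drop of $mw$
into a lower layer. -/
theorem of_smul_average {m : M} {f : Idem M} (hm : m ∉ contraction (sigma (f : M))) (w : W) :
    MonoidAlgebra.of K M m • average ρ (sigma (f : M)) f w = 0 := by
  simp only [average, LinearMap.smul_apply, LinearMap.sum_apply, LinearMap.comp_apply,
    TensorProduct.mk_apply]
  rw [smul_comm, Finset.smul_sum, Finset.sum_eq_zero, smul_zero]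
  intro g _
  rw [TensorProduct.smul_tmul', smul_eq_mul, ← mul_assoc, ← map_mul, of_mul_annihilator,
    TensorProduct.zero_tmul]
  exact fun h => hm (mul_mem_contraction.1 h).1

/-- Let `e` be the chosen idempotent of `Y` and $k = em \in G_e$. Then $mfg = (mfm^\dagger)(kg)$ and
$(kg)^{-1}m = g^{-1}$, so the substitution $g \mapsto kg$ matches the two sums. The group sits at
`e` rather than at `f` because `f` and $mfm^\dagger$ share $\sigma$ but may differ. -/
theorem average_act {m : M} {f : Idem M} (hm : m ∈ contraction (sigma (f : M))) (w : W) :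
    average ρ (sigma (f : M)) (act m f) (ρ m w) =
      MonoidAlgebra.of K M m • average ρ (sigma (f : M)) f w := by
  simp only [average, LinearMap.smul_apply, LinearMap.sum_apply, LinearMap.comp_apply,
    TensorProduct.mk_apply]
  rw [smul_comm]
  congr 1
  rw [Finset.smul_sum]
  set Y := sigma (f : M)
  let k : MaxSubgroup Y.rep := toMaxSubgroup Y.rep Y.sigma_rep ⟨m, hm⟩
  have hk : k.val.val = Y.rep * m := rfl
  have hf : (act m f : M) * Y.rep = act m f :=
    sigma_le_iff.1 ((sigma_act_le m f).trans_eq Y.sigma_rep.symm)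
  symm
  refine Fintype.sum_equiv (M := K[M] ⊗[K] W) (Equiv.mulLeft k) _ _ fun g => ?_
  dsimp only [Equiv.coe_mulLeft]
  rw [TensorProduct.smul_tmul', smul_eq_mul, ← mul_assoc, ← map_mul]
  have h1 : (act m f : M) * (k * g).val.val = m * (f * g.val.val) := by
    rw [MaxSubgroup.val_mul, hk, ← mul_assoc, ← mul_assoc, hf, act_mul_self, mul_assoc]
  have h2 : ((k * g)⁻¹).val.val * m = (g⁻¹).val.val := by
    rw [mul_inv_rev, MaxSubgroup.val_mul, mul_assoc, ← (k⁻¹).val.mul_right, mul_assoc, ← hk,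
      MaxSubgroup.val_inv_mul]
    exact (g⁻¹).val.mul_right
  rw [h1, ← h2, map_mul ρ]
  rfl

/-- The summand of `g` acts as $fg\theta g^{-1} = f + fg(\theta - 1)g^{-1}$. The last term lies in
the ideal spanned by the complement of $M_{\ge Y}$ and so sends `w` into `U`; the $|G|$ copies of
$fw = w$ average to `w`. -/
theorem exists_actionMap_average_eq {f : Idem M} {w : W} {U : Submodule K W}
    (hcard : (Nat.card (MaxSubgroup (sigma (f : M)).rep) : K) ≠ 0) (hf : ρ f w = w)
    (hU : ∀ m ∉ contraction (sigma (f : M)), ρ m w ∈ U) :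
    ∃ u ∈ U, actionMap ρ (average ρ (sigma (f : M)) f w) = w + u := by
  set Y := sigma (f : M)
  have key : ∀ g : MaxSubgroup Y.rep, ∃ u ∈ U,
      actionMap ρ ((MonoidAlgebra.of K M (f * g.val.val) * annihilator K Y) ⊗ₜ
        ρ (g⁻¹).val.val w) = w + u := by
    intro g
    have h1 : (f : M) * g.val.val * (g⁻¹).val.val = f := by
      rw [mul_assoc, MaxSubgroup.val_mul_inv]
      exact sigma_le_iff.1 Y.sigma_rep.ge
    refine ⟨_, asAlgebraHom_mem_of_mem_complementSpan ρ hU (of_mul_mul_of_mem_complementSpan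
      (f * g.val.val) (g⁻¹).val.val (annihilator_sub_one_mem Y)), ?_⟩
    have h2 : MonoidAlgebra.of K M (f * g.val.val) * annihilator K Y *
        MonoidAlgebra.of K M (g⁻¹).val.val = MonoidAlgebra.of K M f +
          MonoidAlgebra.of K M (f * g.val.val) * (annihilator K Y - 1) *
            MonoidAlgebra.of K M (g⁻¹).val.val := by
      rw [mul_sub, sub_mul, mul_one, ← map_mul (MonoidAlgebra.of K M) (_ * _), h1,
        add_sub_cancel]
    calc _ = ρ.asAlgebraHom (MonoidAlgebra.of K M (f * g.val.val) * annihilator K Y *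
          MonoidAlgebra.of K M (g⁻¹).val.val) w := by
          rw [map_mul _ (_ * _), Representation.asAlgebraHom_of]
          rfl
      _ = _ := by
          rw [h2, map_add, LinearMap.add_apply, Representation.asAlgebraHom_of, hf]
  choose u hu hu' using key
  refine ⟨(Nat.card (MaxSubgroup Y.rep) : K)⁻¹ • ∑ g, u g,
    Submodule.smul_mem _ _ (Submodule.sum_mem _ fun g _ => hu g), ?_⟩
  simp only [average, LinearMap.smul_apply, LinearMap.sum_apply, LinearMap.comp_apply,
    TensorProduct.mk_apply, map_smul, map_sum, hu']
  rw [Finset.sum_add_distrib, smul_add, Finset.sum_const, Finset.card_univ,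
    ← Nat.card_eq_fintype_card, ← Nat.cast_smul_eq_nsmul K, smul_smul, inv_mul_cancel₀ hcard,
    one_smul]

end Average

/-! ### Projectivity of the chain modules -/

section ChainModules

variable {M : Type*} [Monoid M] [IsLeftDuo M] [Finite M] [IsRegularMonoid M]
variable {K : Type*} [Field K]

section Inflate

variable {W : Type*} [AddCommMonoid W] [Module K W] {X : Lam M}
  (ρ : Representation K (contraction X) W)

theorem inflate_of_mem {m : M} (h : m ∈ contraction X) : inflate ρ m = ρ ⟨m, h⟩ := by
  simp [inflate, rhoX, h]

theorem inflate_of_notMem {m : M} (h : m ∉ contraction X) : inflate ρ m = 0 := by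
  simp [inflate, rhoX, h]

end Inflate

variable {V : Type*} [AddCommGroup V] [Module K V] {X : Lam M} {q : ℕ}

/-- The largest vertex of a chain. -/
def topVertex (c : Simplex (IdemGE X) q) : Idem M := (c.1 (Fin.last q)).1

theorem le_topVertex (c : Simplex (IdemGE X) q) (i : Fin (q + 1)) : (c.1 i).1 ≤ topVertex c :=
  c.2.monotone (Fin.le_last i)

theorem contraction_topVertex_le (c : Simplex (IdemGE X) q) :
    contraction (sigma (topVertex c : M)) ≤ contraction X := fun _ hm =>
  mem_contraction.2 ((mem_contraction.1 (c.1 (Fin.last q)).2).trans (mem_contraction.1 hm))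

variable (ρ : Representation K (contraction X) V)

variable (q) in
/-- The representation of `M` on `C_q(Δ(B_{≥X}), K) ⊗ V`. -/
noncomputable abbrev chainTensorRep : Representation K M (Chains K (IdemGE X) q ⊗[K] V) :=
  inflate ((chainRep K q (actHom X)).tprod ρ)

theorem chainTensorRep_of_mem {m : M} (h : m ∈ contraction X) (c : Simplex (IdemGE X) q) (v : V) :
    chainTensorRep q ρ m (Finsupp.single c 1 ⊗ₜ v) =
      simplexChain K (actHom X ⟨m, h⟩ ∘ c.1) ⊗ₜ ρ ⟨m, h⟩ v := by
  rw [inflate_of_mem _ h, Representation.tprod_apply, TensorProduct.map_tmul]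
  congr 1
  simp [chainRep, chainMap]

theorem exists_chainTensorRep_eq (m : M) (c : Simplex (IdemGE X) q) (v : V) :
    chainTensorRep q ρ m (Finsupp.single c 1 ⊗ₜ v) = 0 ∨
      ∃ (c' : Simplex (IdemGE X) q) (v' : V), topVertex c' = act m (topVertex c) ∧
        chainTensorRep q ρ m (Finsupp.single c 1 ⊗ₜ v) = Finsupp.single c' 1 ⊗ₜ v' := by
  by_cases h : m ∈ contraction X
  · rw [chainTensorRep_of_mem ρ h]
    by_cases hs : StrictMono (actHom X ⟨m, h⟩ ∘ c.1)
    · exact .inr ⟨⟨_, hs⟩, _, rfl, by rw [simplexChain_of_strictMono K hs]⟩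
    · exact .inl (by rw [simplexChain_of_not K hs, TensorProduct.zero_tmul])
  · exact .inl (by rw [inflate_of_notMem _ h, LinearMap.zero_apply])

theorem exists_chainTensorRep_eq_of_mem {m : M} {c : Simplex (IdemGE X) q}
    (hm : m ∈ contraction (sigma (topVertex c : M))) (v : V) :
    ∃ (c' : Simplex (IdemGE X) q) (v' : V), topVertex c' = act m (topVertex c) ∧
      chainTensorRep q ρ m (Finsupp.single c 1 ⊗ₜ v) = Finsupp.single c' 1 ⊗ₜ v' := by
  have h := contraction_topVertex_le c hm
  have hs : StrictMono (actHom X ⟨m, h⟩ ∘ c.1) :=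
    ((actHom X ⟨m, h⟩).monotone.comp c.2.monotone).strictMono_of_injective fun i j hij =>
      c.2.injective (Subtype.ext
        (act_injOn hm (le_topVertex c i) (le_topVertex c j) (congrArg Subtype.val hij)))
  refine ⟨⟨_, hs⟩, ρ ⟨m, h⟩ v, rfl, ?_⟩
  rw [chainTensorRep_of_mem ρ h, simplexChain_of_strictMono K hs]

variable (K V X q) in
/-- The span of the `c ⊗ v` for which the largest vertex of `c` has rank less than `n`. -/
noncomputable def rankFiltration (n : ℕ) : Submodule K (Chains K (IdemGE X) q ⊗[K] V) :=
  Submodule.span K {w | ∃ (c : Simplex (IdemGE X) q) (v : V),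
    rank (topVertex c) < n ∧ w = Finsupp.single c 1 ⊗ₜ v}

theorem rankFiltration_zero : rankFiltration K V X q 0 = ⊥ := by
  refine Submodule.span_eq_bot.2 ?_
  rintro _ ⟨c, v, h, rfl⟩
  exact absurd h (Nat.not_lt_zero _)

theorem rankFiltration_eq_top : rankFiltration K V X q (Nat.card (Idem M) + 1) = ⊤ := by
  rw [eq_top_iff, ← TensorProduct.span_tmul_eq_top, Submodule.span_le]
  rintro _ ⟨x, v, rfl⟩
  induction x using Finsupp.induction_linear with
  | zero => rw [TensorProduct.zero_tmul]; exact zero_mem _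
  | add x y hx hy => rw [TensorProduct.add_tmul]; exact add_mem hx hy
  | single c a =>
    refine Submodule.subset_span ⟨c, a • v, ?_, ?_⟩
    · exact Nat.lt_succ_of_le (Set.ncard_le_card _)
    · rw [← TensorProduct.smul_tmul, Finsupp.smul_single, smul_eq_mul, mul_one]

theorem chainTensorRep_mem_rankFiltration {m : M} {c : Simplex (IdemGE X) q} {n : ℕ}
    (h : rank (act m (topVertex c)) < n) (v : V) :
    chainTensorRep q ρ m (Finsupp.single c 1 ⊗ₜ v) ∈ rankFiltration K V X q n := by
  rcases exists_chainTensorRep_eq ρ m c v with h0 | ⟨c', v', ht, h0⟩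
  · rw [h0]; exact zero_mem _
  · exact Submodule.subset_span ⟨c', v', ht ▸ h, h0⟩

variable (q) in
open Classical in
/-- The map on `C_q(Δ(B_{≥X}), K) ⊗ V` which is `average` on the chains whose largest vertex has
rank `n`, and zero on the other chains. -/
noncomputable def layerMap (n : ℕ) :
    Chains K (IdemGE X) q ⊗[K] V →ₗ[K] K[M] ⊗[K] (Chains K (IdemGE X) q ⊗[K] V) :=
  TensorProduct.lift (Finsupp.linearCombination K fun c : Simplex (IdemGE X) q =>
    if rank (topVertex c) = n then
      average (chainTensorRep q ρ) (sigma (topVertex c : M)) (topVertex c) ∘ₗ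
        TensorProduct.mk K (Chains K (IdemGE X) q) V (Finsupp.single c 1)
    else 0)

theorem layerMap_of_eq {n : ℕ} {c : Simplex (IdemGE X) q} (h : rank (topVertex c) = n) (v : V) :
    layerMap q ρ n (Finsupp.single c 1 ⊗ₜ v) =
      average (chainTensorRep q ρ) (sigma (topVertex c : M)) (topVertex c)
        (Finsupp.single c 1 ⊗ₜ v) := by
  simp [layerMap, h]

theorem layerMap_of_ne {n : ℕ} {c : Simplex (IdemGE X) q} (h : rank (topVertex c) ≠ n) (v : V) :
    layerMap q ρ n (Finsupp.single c 1 ⊗ₜ v) = 0 := by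
  simp [layerMap, h]

theorem layerMap_eq_zero {n : ℕ} {w : Chains K (IdemGE X) q ⊗[K] V}
    (hw : w ∈ rankFiltration K V X q n) : layerMap q ρ n w = 0 := by
  refine (Submodule.span_le (p := LinearMap.ker (layerMap q ρ n))).2 ?_ hw
  rintro _ ⟨c, v, h, rfl⟩
  exact layerMap_of_ne ρ h.ne v

/-- Below rank `n` both sides vanish. At rank `n`, either `m` preserves $\sigma$ of the top vertex
and `average_act` applies, or the rank drops and both sides vanish again. -/
theorem layerMap_equivariant {n : ℕ} {c : Simplex (IdemGE X) q} (h : rank (topVertex c) < n + 1)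
    (v : V) (m : M) :
    layerMap q ρ n (chainTensorRep q ρ m (Finsupp.single c 1 ⊗ₜ v)) =
      MonoidAlgebra.of K M m • layerMap q ρ n (Finsupp.single c 1 ⊗ₜ v) := by
  rcases (Nat.lt_succ_iff.1 h).lt_or_eq with h | h
  · rw [layerMap_of_ne ρ h.ne, smul_zero, layerMap_eq_zero ρ
      (chainTensorRep_mem_rankFiltration ρ ((rank_act_le m _).trans_lt h) v)]
  rw [layerMap_of_eq ρ h]
  by_cases hm : m ∈ contraction (sigma (topVertex c : M))
  · rw [← average_act _ hm]
    obtain ⟨c', v', ht, h0⟩ := exists_chainTensorRep_eq_of_mem ρ hm v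
    have hσ := sigma_act_eq_iff.2 hm
    rw [h0, layerMap_of_eq ρ (by rw [ht, rank_eq hσ, h]), ht, hσ]
  · rw [of_smul_average _ hm, layerMap_eq_zero ρ
      (chainTensorRep_mem_rankFiltration ρ ((rank_act_lt hm).trans_eq h) v)]

/-- If $p \le f$ then $fpf = fp = p$, so the top vertex fixes every vertex of its chain. -/
theorem chainTensorRep_topVertex
    (hρ : ∀ (f : Idem M) (hf : (f : M) ∈ contraction X), ρ ⟨f, hf⟩ = 1)
    (c : Simplex (IdemGE X) q) (v : V) :
    chainTensorRep q ρ (topVertex c : M) (Finsupp.single c 1 ⊗ₜ v) = Finsupp.single c 1 ⊗ₜ v := by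
  have h : (topVertex c : M) ∈ contraction X := (c.1 (Fin.last q)).2
  have hc : actHom X ⟨topVertex c, h⟩ ∘ c.1 = c.1 :=
    funext fun i => Subtype.ext (act_idem_of_le (le_topVertex c i))
  rw [chainTensorRep_of_mem ρ h, hc, simplexChain_of_strictMono K c.2, hρ]
  rfl

variable (q) in
theorem projective_chainTensorRep
    (hK : ∀ f : Idem M, ¬ (ringChar K ∣ Nat.card (MaxSubgroup f)))
    (hρ : ∀ (f : Idem M) (hf : (f : M) ∈ contraction X), ρ ⟨f, hf⟩ = 1) :
    Module.Projective K[M] (chainTensorRep q ρ).asModule := by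
  refine projective_of_filtration (chainTensorRep q ρ) (rankFiltration K V X q)
    rankFiltration_zero _ rankFiltration_eq_top fun n => ⟨layerMap q ρ n, fun w hw => ?_⟩
  induction hw using Submodule.span_induction with
  | mem w hw =>
    obtain ⟨c, v, h, rfl⟩ := hw
    refine ⟨layerMap_equivariant ρ h v, ?_⟩
    rcases (Nat.lt_succ_iff.1 h).lt_or_eq with h | h
    -- `layerMap` vanishes on a lower chain, so the error is the negative of the element itself.
    · refine ⟨(-1 : K) • (Finsupp.single c 1 ⊗ₜ v),
        Submodule.smul_mem _ _ (Submodule.subset_span ⟨c, v, h, rfl⟩), ?_⟩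
      rw [layerMap_of_ne ρ h.ne, map_zero, add_neg_one_smul]
    · rw [layerMap_of_eq ρ h]
      exact exists_actionMap_average_eq (chainTensorRep q ρ)
        (fun h0 => hK _ ((ringChar.spec K _).1 h0))
        (chainTensorRep_topVertex ρ hρ c v) fun m hm =>
          chainTensorRep_mem_rankFiltration ρ ((rank_act_lt hm).trans_eq h) v
  | zero => exact ⟨fun m => by simp only [map_zero, smul_zero], 0, zero_mem _, by simp⟩
  | add x y _ _ hx hy =>
    obtain ⟨hx, u, hu, hx'⟩ := hx
    obtain ⟨hy, u', hu', hy'⟩ := hy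
    refine ⟨fun m => by rw [map_add, map_add, hx, hy, map_add, smul_add],
      u + u', add_mem hu hu', ?_⟩
    rw [map_add, map_add, hx', hy', add_add_add_comm]
  | smul a x _ hx =>
    obtain ⟨hx, u, hu, hx'⟩ := hx
    refine ⟨fun m => by rw [map_smul, map_smul, hx, map_smul, smul_comm],
      a • u, Submodule.smul_mem _ _ hu, ?_⟩
    rw [map_smul, map_smul, hx', smul_add]

/-- $X \le \sigma(f)$ means $ef = e$, and `e` is the identity of $G_X$. -/
theorem contractionRep_idem (e : Idem M) (he : sigma (e : M) = X)
    (τ : Representation K (MaxSubgroup e) V) (f : Idem M) (hf : (f : M) ∈ contraction X) :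
    contractionRep e he τ ⟨f, hf⟩ = 1 := by
  have : toMaxSubgroup e he ⟨f, hf⟩ = 1 := by
    apply Units.ext
    apply LocalMonoid.ext
    rw [coe_toMaxSubgroup]
    exact sigma_le_iff.1 (he.trans_le hf)
  rw [contractionRep, MonoidHom.comp_apply, this, map_one]

end ChainModules

end LeftDuo

theorem theoremt {M : Type*} [Monoid M] [Finite M] [IsRegularMonoid M] [IsLeftDuo M]
    {K : Type*} [Field K]
    (hK : ∀ f : Idem M, ¬ (ringChar K ∣ Nat.card (MaxSubgroup f)))
    (X : Lam M) (e : Idem M) (he : sigma (e : M) = X)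
    {V : Type*} [AddCommGroup V] [Module K V] (τ : Representation K (MaxSubgroup e) V)
    (hV : IsSimpleModule K[MaxSubgroup e] τ.asModule) :
    IsProjectiveResolution (resolutionD e he τ) (resolutionAug e he τ) where
  projective q := projective_chainTensorRep q _ hK (contractionRep_idem e he τ)
  exact_succ := resolutionD_exact e he τ
  exact_zero := resolutionAug_exact e he τ
  surjective := resolutionAug_surjective e he τ
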